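/- **Setting.** Fix integers $K\ge 1$, $N\ge 0$, $s\ge 1$, a known variance $\sigma^2>0$ and $\delta\in(0,1)$. An environment is a vector of means $v=(\mu_{v,1},\dots,\mu_{v,K})\in\mathbb R^K$; playing arm $i$ gives a reward with law $v_i=\mathcal N(\mu_{v,i},\sigma^2)$, independently of the past given the arm. Its set of change points is $\underline x^*_v=\{j\in\{1,\dots,K-1\}:\mu_{v,j}\ne\mu_{v,j+1}\}$, and the magnitude of the change at $j$ is $|\mu_{v,j}-\mu_{v,j+1}|$. Let $V^{s}_{K,N}$ be the set of environments with exactly $N$ change points $x^*_{v,1}<\dots<x^*_{v,N}$ such that $x^*_{v,i+1}-x^*_{v,i}\ge s$ for $1\le i<N$, and write $\Delta_i=|\mu_{v,x^*_{v,i}}-\mu_{v,x^*_{v,i}+1}|$. (For $s=1$ these are all environments with exactly $N$ change points; for $s=2$ those whose change points are separated by at least one action, $x^*_{v,i}+1<x^*_{v,i+1}$.) A policy $\pi$ consists of a (possibly randomised) sampling rule that chooses the next arm given the arms and rewards seen so far, a stopping time $\tau$ for the filtration generated by the arms and rewards, and an estimate $\hat{\underline x}_\tau$ measurable with respect to the information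 available at time $\tau$; $\mathbb P_{\pi,v}$ is the resulting law. The policy is Exact-$(N,\delta)$ over $V^s_{K,N}$ if for every $v\in V^{s}_{K,N}$ $$\mathbb P_{\pi,v}(\hat{\underline x}_\tau=\underline x^*_v)>1-\delta,\qquad \mathbb P_{\pi,v}(\tau<\infty)=1 .$$ Let $D$ be the Kullback–Leibler divergence, $\mathcal P_K$ the standard simplex in $\mathbb R^K$, $V^{\mathrm{alt},s}_{K,N}(v)=\{v'\in V^s_{K,N}:\underline x^*_{v'}\ne\underline x^*_v\}$, and $$c_2^*(v)^{-1}=\sup_{\alpha\in\mathcal P_K}\ \inf_{v'\in V^{\mathrm{alt},s}_{K,N}(v)}\ \sum_{i=1}^K\alpha_i D(v_i,v_i')$$ in $[0,\infty]$ (with $\inf\emptyset=\infty$, $1/\infty=0$). **Theorem.** Let $\pi$ be an Exact-$(N,\delta)$ policy over $V^s_{K,N}$ with stopping time $\tau$, and let $v\in V^s_{K,N}$. Then $$\mathbb E_{\pi,v}[\tau]\ \ge\ c_2^*(v)\,\log^+\!\Big(\frac1{4\delta}\Big),$$ where $\log^+=\max(\log,0)$. If moreover $K\ge 3$ and $v\in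 V^{s+1}_{K,N}$ (consecutive change points of $v$ are at distance at least $s+1$), then $$c_2^*(v)\ \ge\ 4\sigma^2\sum_{i=1}^N\frac1{\Delta_i^2},$$ and consequently $$\mathbb E_{\pi,v}[\tau]\ \ge\ c_2^*(v)\log^+\!\Big(\frac1{4\delta}\Big)\ \ge\ 4\sigma^2\log^+\!\Big(\frac1{4\delta}\Big)\sum_{i=1}^N\frac1{\Delta_i^2}.$$ -/

import Mathlib

open MeasureTheory ProbabilityTheory InformationTheory
open scoped ENNReal NNReal

namespace ChangePointBandit

/-! ### Environments

There are `K` arms, indexed from left to right by `Fin K`; an environment is the vector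
`μ : Fin K → ℝ` of its mean rewards. -/

open scoped Classical in
/-- The set of change points of `μ`: the arms `j` that have a right neighbour `j + 1` and satisfy
`μ j ≠ μ (j + 1)`. -/
noncomputable def changePoints {K : ℕ} (μ : Fin K → ℝ) : Finset (Fin K) :=
  Finset.univ.filter fun j => ∃ h : (j : ℕ) + 1 < K, μ j ≠ μ ⟨j + 1, h⟩

/-- The magnitude `|μ j - μ (j + 1)|` of the change at `j` (`0` if `j` is the last arm, which is
never a change point). -/
noncomputable def jump {K : ℕ} (μ : Fin K → ℝ) (j : Fin K) : ℝ :=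
  if h : (j : ℕ) + 1 < K then |μ j - μ ⟨j + 1, h⟩| else 0

/-- The environments with `K` arms and exactly `N` change points, any two of which are at distance
at least `s` from each other. For `s ≤ 1` there is no separation constraint; `s = 2` says
`x_i + 1 < x_{i+1}` for consecutive change points. -/
def envs (K N s : ℕ) : Set (Fin K → ℝ) :=
  {μ | (changePoints μ).card = N ∧
    ∀ i ∈ changePoints μ, ∀ j ∈ changePoints μ, i < j → (i : ℕ) + s ≤ (j : ℕ)}

/-- The alternatives to `μ`: the environments of the class with another set of change points. -/
def altEnvs {K : ℕ} (N s : ℕ) (μ : Fin K → ℝ) : Set (Fin K → ℝ) :=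
  {μ' ∈ envs K N s | changePoints μ' ≠ changePoints μ}

/-- The characteristic time `c₂*(μ)`, the inverse of
`sup_α inf_{μ'} ∑ i, α i * D(N(μ i, σ²), N(μ' i, σ²))`, in `[0, ∞]`. -/
noncomputable def cStar {K : ℕ} (σsq : ℝ≥0) (N s : ℕ) (μ : Fin K → ℝ) : ℝ≥0∞ :=
  (⨆ α ∈ stdSimplex ℝ (Fin K), ⨅ μ' ∈ altEnvs N s μ,
    ∑ i, ENNReal.ofReal (α i) * klDiv (gaussianReal (μ i) σsq) (gaussianReal (μ' i) σsq))⁻¹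

/-! ### Policies -/

/-- What is seen in one round: the arm that was played and the reward. -/
abbrev Round (K : ℕ) : Type := Fin K × ℝ

/-- The information after `n` rounds; `ω i` is the round with number `i + 1`. -/
def history (K : ℕ) : Filtration ℕ (inferInstance : MeasurableSpace (ℕ → Round K)) where
  seq n := MeasurableSpace.comap (fun (ω : ℕ → Round K) (i : Fin n) => ω i) inferInstance
  mono' := by
    intro m n hmn
    have h : (fun (ω : ℕ → Round K) (i : Fin m) => ω i) =
        (fun (x : Fin n → Round K) (i : Fin m) => x (Fin.castLE hmn i)) ∘
          (fun (ω : ℕ → Round K) (i : Fin n) => ω i) := rfl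
    change MeasurableSpace.comap _ _ ≤ MeasurableSpace.comap _ _
    rw [h, ← MeasurableSpace.comap_comp]
    exact MeasurableSpace.comap_mono (Measurable.comap_le (by fun_prop))
  le' n := Measurable.comap_le (by fun_prop)

/-- A policy: a (possibly randomised) sampling rule, which gives the law of the next arm given the
first `n` rounds; a stopping time; and a recommendation that depends on what has been seen up to
the stopping time. -/
structure Policy (K : ℕ) where
  sample : ∀ n : ℕ, Kernel (Fin n → Round K) (Fin K)
  sample_markov : ∀ n, IsMarkovKernel (sample n)
  stopTime : (ℕ → Round K) → ℕ∞
  stopTime_isStoppingTime : IsStoppingTime (history K) stopTime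
  recommend : (ℕ → Round K) → Finset (Fin K)
  recommend_measurable : ∀ S : Finset (Fin K),
    MeasurableSet[stopTime_isStoppingTime.measurableSpace] {ω | recommend ω = S}

attribute [instance] Policy.sample_markov

/-- The rewards of the environment `μ`: arm `a` gives a reward with law `N(μ a, σ²)`. -/
noncomputable def rewardKernel {K : ℕ} (σsq : ℝ≥0) (μ : Fin K → ℝ) : Kernel (Fin K) ℝ where
  toFun a := gaussianReal (μ a) σsq
  measurable' := measurable_of_countable _

instance {K : ℕ} (σsq : ℝ≥0) (μ : Fin K → ℝ) : IsMarkovKernel (rewardKernel σsq μ) :=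
  ⟨fun a => inferInstanceAs (IsProbabilityMeasure (gaussianReal (μ a) σsq))⟩

namespace Policy

variable {K : ℕ} (π : Policy K) (σsq : ℝ≥0) (μ : Fin K → ℝ)

/-- The law of the next round given the first `n` rounds: an arm is drawn by the sampling rule,
then its reward is drawn from the environment. -/
noncomputable def step (n : ℕ) : Kernel (Fin n → Round K) (Round K) :=
  π.sample n ⊗ₖ Kernel.prodMkLeft (Fin n → Round K) (rewardKernel σsq μ)

instance (n : ℕ) : IsMarkovKernel (π.step σsq μ n) := by
  unfold step; infer_instance

/-- `step (n + 1)`, with the first `n + 1` rounds indexed by `{i // i ≤ n}`. -/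
noncomputable def stepIic (n : ℕ) :
    Kernel ((i : Finset.Iic n) → (fun _ : ℕ => Round K) i) (Round K) :=
  (π.step σsq μ (n + 1)).comap
    (fun x (i : Fin (n + 1)) => x ⟨i, Finset.mem_Iic.2 (Nat.lt_succ_iff.1 i.2)⟩)
    (measurable_pi_lambda _ fun i => measurable_pi_apply _)

instance (n : ℕ) : IsMarkovKernel (π.stepIic σsq μ n) := by
  unfold stepIic; infer_instance

/-- The law of the whole sequence of rounds when the policy interacts with the environment `μ`. -/
noncomputable def law : Measure (ℕ → Round K) :=
  Kernel.trajMeasure (X := fun _ => Round K) (π.step σsq μ 0 Fin.elim0) (π.stepIic σsq μ)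

/-- The expected stopping time, in `[0, ∞]`. -/
noncomputable def expectedStop : ℝ≥0∞ :=
  ∫⁻ ω, (π.stopTime ω : ℝ≥0∞) ∂(π.law σsq μ)

/-- An Exact-`(N, δ)` policy over the environments in `envs K N s`: in each of them it returns the
set of change points with probability greater than `1 - δ` and stops almost surely. -/
def IsExact (N s : ℕ) (δ : ℝ) : Prop :=
  ∀ μ ∈ envs K N s,
    ENNReal.ofReal (1 - δ) < π.law σsq μ {ω | π.recommend ω = changePoints μ} ∧
    π.law σsq μ {ω | π.stopTime ω < ⊤} = 1

end Policy

end ChangePointBandit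

/-! The first bound is a transportation argument. Let $v'$ be an alternative. By Wald's identity
(`lintegral_sum_rounds`), the expected log-likelihood ratio of the rounds played is $\sum_a \mathbb
E_v[N_a]\,D(v_a,v'_a)$, where $N_a$ counts the plays of arm $a$. The event that the policy returns
the change points of $v$ is likely under $v$ and unlikely under $v'$. A change of measure up to the
stopping time (`law_apply_eq_stoppedRatio`) therefore forces this expectation to be at least the
binary divergence of $1-\delta$ from $\delta$, hence at least $\log(1/4\delta)$ when $\delta<1/4$
(`log_le_integral_of_likelihood_ratio`). Dividing the expected plays by $\mathbb E[\tau]$ gives a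
point of the simplex whose infimum over the alternatives is at least $\log(1/4\delta)/\mathbb
E[\tau]$.

For the second bound, fix weights $\alpha$ and move a single change $j$ to a neighbouring arm.
Changes at distance $s+1$ are then still at distance $s$, so this is an alternative. With a good
choice of direction or level, $\sum_i\alpha_i(\mu_i-\mu'_i)^2$ is at most
$(\alpha_j+\alpha_{j+1})\Delta_j^2/2$ (`exists_altEnvs_sum_le`). The pairs $\{j,j+1\}$ are disjoint,
so their weights sum to at most $1$, and some $j$ has
$(\alpha_j+\alpha_{j+1})\Delta_j^2\le(\sum_i\Delta_i^{-2})^{-1}$ (`exists_changePoint_weight_le`).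
The factor $1/(2\sigma^2)$ of the Gaussian divergence gives the constant $4\sigma^2$. -/

namespace ChangePointBandit

/-! ### Gaussian laws with a common variance -/

lemma measurable_ofReal_exp_neg {α : Type*} [MeasurableSpace α] {f : α → ℝ} (hf : Measurable f) :
    Measurable fun x => ENNReal.ofReal (Real.exp (-f x)) := by
  fun_prop

/-- The log-likelihood ratio of `N(m, v)` against `N(m', v)`. -/
noncomputable def gaussianLogRatio (v : ℝ≥0) (m m' x : ℝ) : ℝ :=
  (m - m') * (2 * x - m - m') / (2 * v)

lemma measurable_gaussianLogRatio (v : ℝ≥0) (m m' : ℝ) :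
    Measurable (gaussianLogRatio v m m') := by
  unfold gaussianLogRatio; fun_prop

lemma gaussianReal_withDensity_exp {v : ℝ≥0} (hv : v ≠ 0) (m m' : ℝ) :
    (gaussianReal m v).withDensity
      (fun x => ENNReal.ofReal (Real.exp (-gaussianLogRatio v m m' x))) = gaussianReal m' v := by
  have hm : Measurable fun x => ENNReal.ofReal (Real.exp (-gaussianLogRatio v m m' x)) :=
    (measurable_gaussianLogRatio v m m').neg.exp.ennreal_ofReal
  rw [gaussianReal_of_var_ne_zero m hv, gaussianReal_of_var_ne_zero m' hv,
    ← withDensity_mul _ (measurable_gaussianPDF m v) hm]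
  congr 1
  ext x
  have hv' : (v : ℝ) ≠ 0 := by exact_mod_cast hv
  rw [Pi.mul_apply, gaussianPDF, gaussianPDF,
    ← ENNReal.ofReal_mul (gaussianPDFReal_nonneg _ _ _), gaussianPDFReal, gaussianPDFReal,
    mul_assoc, ← Real.exp_add]
  congr 3
  unfold gaussianLogRatio
  field_simp
  ring

lemma integrable_gaussianLogRatio (v : ℝ≥0) (m m' : ℝ) :
    Integrable (gaussianLogRatio v m m') (gaussianReal m v) := by
  have h : Integrable (fun x : ℝ => x) (gaussianReal m v) :=
    (memLp_id_gaussianReal (μ := m) (v := v) 1).integrable (by simp)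
  have h2 : gaussianLogRatio v m m' =
      fun x => (m - m') / v * x - (m - m') * (m + m') / (2 * v) := by
    funext x; unfold gaussianLogRatio; ring
  rw [h2]
  exact (h.const_mul _).sub (integrable_const _)

lemma integral_gaussianLogRatio (v : ℝ≥0) (m m' : ℝ) :
    ∫ x, gaussianLogRatio v m m' x ∂(gaussianReal m v) = (m - m') ^ 2 / (2 * v) := by
  have h : Integrable (fun x : ℝ => x) (gaussianReal m v) :=
    (memLp_id_gaussianReal (μ := m) (v := v) 1).integrable (by simp)
  have h2 : ∀ x, gaussianLogRatio v m m' x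
      = (m - m') / v * x - (m - m') * (m + m') / (2 * v) := by
    intro x; unfold gaussianLogRatio; ring
  simp_rw [h2]
  rw [integral_sub (h.const_mul _) (integrable_const _), integral_const_mul,
    integral_id_gaussianReal, integral_const]
  simp
  ring

/-- The Kullback-Leibler divergence of two Gaussian laws with the same variance. -/
lemma klDiv_gaussianReal {v : ℝ≥0} (hv : v ≠ 0) (m m' : ℝ) :
    klDiv (gaussianReal m v) (gaussianReal m' v) = ENNReal.ofReal ((m - m') ^ 2 / (2 * v)) := by
  -- The means are swapped here so that the first law gets a density with respect to the second.
  have hw := gaussianReal_withDensity_exp hv m' m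
  have hac : gaussianReal m v ≪ gaussianReal m' v := by
    rw [← hw]; exact withDensity_absolutelyContinuous _ _
  have hllr : llr (gaussianReal m v) (gaussianReal m' v) =ᵐ[gaussianReal m v]
      gaussianLogRatio v m m' := by
    have h1 : (gaussianReal m v).rnDeriv (gaussianReal m' v) =ᵐ[gaussianReal m' v]
        fun x => ENNReal.ofReal (Real.exp (-gaussianLogRatio v m' m x)) := by
      have := Measure.rnDeriv_withDensity (gaussianReal m' v)
        (measurable_gaussianLogRatio v m' m).neg.exp.ennreal_ofReal
      exact hw ▸ this
    filter_upwards [hac.ae_le h1] with x hx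
    rw [llr, hx, ENNReal.toReal_ofReal (Real.exp_pos _).le, Real.log_exp]
    unfold gaussianLogRatio; ring
  rw [klDiv_of_ac_of_integrable hac ((integrable_congr hllr).2 (integrable_gaussianLogRatio v m m')),
    integral_congr_ae hllr, integral_gaussianLogRatio]
  simp

/-! ### The law of the rounds -/

section Law

variable {K : ℕ}

/-- The first `n` rounds. -/
def firstRounds (n : ℕ) (ω : ℕ → Round K) : Fin n → Round K := fun i => ω i

@[fun_prop]
lemma measurable_firstRounds (n : ℕ) : Measurable (firstRounds (K := K) n) := by
  unfold firstRounds; fun_prop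

lemma firstRounds_succ (n : ℕ) (ω : ℕ → Round K) :
    firstRounds (n + 1) ω = Fin.snoc (firstRounds n ω) (ω n) := by
  ext i : 1
  refine Fin.lastCases ?_ (fun i => ?_) i <;> simp [firstRounds]

lemma measurable_snoc (n : ℕ) :
    Measurable fun p : (Fin n → Round K) × Round K =>
      (Fin.snoc p.1 p.2 : Fin (n + 1) → Round K) := by
  refine measurable_pi_lambda _ fun i => ?_
  refine Fin.lastCases ?_ (fun i => ?_) i
  · simpa using measurable_snd
  · simp only [Fin.snoc_castSucc]
    fun_prop

variable (π : Policy K) (σsq : ℝ≥0) (μ : Fin K → ℝ)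

instance : IsProbabilityMeasure (π.law σsq μ) := by
  unfold Policy.law; infer_instance

/-- The defining disintegration of the trajectory measure, with histories indexed by `Fin n`. The
case `n = 0` is separate because the first round is the initial law of the construction and not one
of its transition kernels. -/
lemma map_law_firstRounds_prod (n : ℕ) :
    (π.law σsq μ).map (fun ω => (firstRounds n ω, ω n)) =
      (π.law σsq μ).map (firstRounds n) ⊗ₘ π.step σsq μ n := by
  cases n with
  | zero =>
    have h0 : (π.law σsq μ).map (fun ω => ω 0) = π.step σsq μ 0 Fin.elim0 := by
      let e := (MeasurableEquiv.piUnique (fun i : Finset.Iic 0 => (fun _ : ℕ => Round K) i)).symm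
      have h : (π.law σsq μ).map (Preorder.frestrictLe (π := fun _ : ℕ => Round K) 0) =
          (π.step σsq μ 0 Fin.elim0).map e := by
        rw [Policy.law, Kernel.trajMeasure, Measure.map_comp _ _ (by fun_prop),
          Kernel.traj_map_frestrictLe, Kernel.partialTraj_self, Measure.id_comp]
      have h1 : (fun ω : ℕ → Round K => ω 0) = e.symm ∘ Preorder.frestrictLe 0 := rfl
      rw [h1, ← Measure.map_map e.symm.measurable (by fun_prop), h,
        Measure.map_map e.symm.measurable e.measurable]
      simp
    have h2 : firstRounds (K := K) 0 = fun _ => Fin.elim0 := by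
      funext ω; exact Subsingleton.elim _ _
    ext s hs
    have hs' : Measurable (Prod.mk (β := Round K) (Fin.elim0 : Fin 0 → Round K)) :=
      measurable_prodMk_left
    rw [h2, Measure.map_const, measure_univ, one_smul, Measure.compProd_apply hs,
      lintegral_dirac' _ (Kernel.measurable_kernel_prodMk_left hs), ← h0,
      Measure.map_apply (by fun_prop) hs, Measure.map_apply (by fun_prop) (hs' hs)]
    rfl
  | succ n =>
    have h := Kernel.map_frestrictLe_trajMeasure_compProd_eq_map_trajMeasure
      (X := fun _ => Round K) (μ₀ := π.step σsq μ 0 Fin.elim0) (κ := π.stepIic σsq μ) (a := n)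
    let e : ((i : Finset.Iic n) → (fun _ : ℕ => Round K) i) → (Fin (n + 1) → Round K) :=
      fun x i => x ⟨i, Finset.mem_Iic.2 (Nat.lt_succ_iff.1 i.2)⟩
    have he : Measurable e := measurable_pi_lambda _ fun i => measurable_pi_apply _
    have h1 : (fun ω : ℕ → Round K => (firstRounds (n + 1) ω, ω (n + 1))) =
        Prod.map e id ∘ (fun ω => (Preorder.frestrictLe n ω, ω (n + 1))) := rfl
    have h2 : firstRounds (K := K) (n + 1) = e ∘ Preorder.frestrictLe n := rfl
    rw [h1, ← Measure.map_map (by fun_prop) (by fun_prop), Policy.law, ← h, h2,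
      ← Measure.map_map he (by fun_prop)]
    ext s hs
    rw [Measure.map_apply (by fun_prop) hs, Measure.compProd_apply (hs.preimage (by fun_prop)),
      Measure.compProd_apply hs, lintegral_map (Kernel.measurable_kernel_prodMk_left hs) he]
    rfl

lemma lintegral_law_round (n : ℕ) {F : (Fin n → Round K) → Round K → ℝ≥0∞}
    (hF : Measurable F.uncurry) :
    ∫⁻ ω, F (firstRounds n ω) (ω n) ∂(π.law σsq μ) =
      ∫⁻ ω, ∫⁻ r, F (firstRounds n ω) r ∂(π.step σsq μ n (firstRounds n ω)) ∂(π.law σsq μ) := by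
  have h := congrArg (fun m => ∫⁻ p, F.uncurry p ∂m) (map_law_firstRounds_prod π σsq μ n)
  rw [lintegral_map hF (by fun_prop), Measure.lintegral_compProd hF,
    lintegral_map (Measurable.lintegral_kernel_prod_right' hF) (by fun_prop)] at h
  exact h

lemma lintegral_step (n : ℕ) (x : Fin n → Round K) {f : Round K → ℝ≥0∞} (hf : Measurable f) :
    ∫⁻ r, f r ∂(π.step σsq μ n x) =
      ∫⁻ a, ∫⁻ y, f (a, y) ∂(gaussianReal (μ a) σsq) ∂(π.sample n x) := by
  rw [Policy.step, Kernel.lintegral_compProd _ _ _ hf]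
  rfl

/-- The log-likelihood ratio of one round. -/
noncomputable def roundRatio (μ' : Fin K → ℝ) (r : Round K) : ℝ :=
  gaussianLogRatio σsq (μ r.1) (μ' r.1) r.2

lemma measurable_roundRatio (μ' : Fin K → ℝ) : Measurable (roundRatio σsq μ μ') :=
  measurable_from_prod_countable_right fun a => measurable_gaussianLogRatio σsq (μ a) (μ' a)

variable {σsq}

/-- The arm has the same conditional law in both environments, so the sampling rule cancels and only
the reward density remains. -/
lemma lintegral_step_eq_ratio (hσ : σsq ≠ 0) (μ' : Fin K → ℝ) (n : ℕ) (x : Fin n → Round K)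
    {f : Round K → ℝ≥0∞} (hf : Measurable f) :
    ∫⁻ r, f r ∂(π.step σsq μ' n x) =
      ∫⁻ r, ENNReal.ofReal (Real.exp (-roundRatio σsq μ μ' r)) * f r ∂(π.step σsq μ n x) := by
  rw [lintegral_step _ _ _ _ _ hf, lintegral_step _ _ _ _ _
    (f := fun r => ENNReal.ofReal (Real.exp (-roundRatio σsq μ μ' r)) * f r)
    ((measurable_roundRatio σsq μ μ').neg.exp.ennreal_ofReal.mul hf)]
  congr 1 with a
  rw [← gaussianReal_withDensity_exp hσ (μ a) (μ' a), lintegral_withDensity_eq_lintegral_mul _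
    (measurable_ofReal_exp_neg (measurable_gaussianLogRatio _ _ _)) (by fun_prop)]
  rfl

/-- Change of measure on the first `n` rounds. -/
lemma lintegral_law_eq_ratio (hσ : σsq ≠ 0) (μ' : Fin K → ℝ) (n : ℕ)
    {g : (Fin n → Round K) → ℝ≥0∞} (hg : Measurable g) :
    ∫⁻ ω, g (firstRounds n ω) ∂(π.law σsq μ') =
      ∫⁻ ω, ENNReal.ofReal (Real.exp (-∑ i ∈ Finset.range n, roundRatio σsq μ μ' (ω i))) *
        g (firstRounds n ω) ∂(π.law σsq μ) := by
  have hr := measurable_roundRatio σsq μ μ'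
  induction n with
  | zero =>
    have : ∀ ω : ℕ → Round K, firstRounds 0 ω = Fin.elim0 := fun ω => Subsingleton.elim _ _
    simp [this]
  | succ n ih =>
    have hF : Measurable (Function.uncurry fun (x : Fin n → Round K) r =>
        g (Fin.snoc x r : Fin (n + 1) → Round K)) := hg.comp (measurable_snoc n)
    have hG : Measurable (Function.uncurry fun (x : Fin n → Round K) r =>
        ENNReal.ofReal (Real.exp (-∑ i : Fin n, roundRatio σsq μ μ' (x i))) *
          (ENNReal.ofReal (Real.exp (-roundRatio σsq μ μ' r)) *
            g (Fin.snoc x r : Fin (n + 1) → Round K))) := by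
      refine Measurable.mul ?_ (Measurable.mul ?_ hF)
      · fun_prop
      · fun_prop
    have hsum : ∀ ω : ℕ → Round K, ∑ i ∈ Finset.range n, roundRatio σsq μ μ' (ω i) =
        ∑ i : Fin n, roundRatio σsq μ μ' (firstRounds n ω i) := fun ω =>
      Finset.sum_range fun i => roundRatio σsq μ μ' (ω i)
    simp_rw [Finset.sum_range_succ, neg_add, Real.exp_add, ENNReal.ofReal_mul (Real.exp_pos _).le,
      firstRounds_succ, mul_assoc, hsum]
    rw [lintegral_law_round π σsq μ' n hF, lintegral_law_round π σsq μ n hG,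
      ih (Measurable.lintegral_kernel_prod_right hF)]
    refine lintegral_congr fun ω => ?_
    rw [hsum, lintegral_step_eq_ratio π μ hσ μ' n _ (by fun_prop), lintegral_const_mul]
    fun_prop

end Law

end ChangePointBandit

namespace ChangePointBandit

/-! ### Change of measure and Wald's identity at the stopping time -/

section Stopping

variable {K : ℕ} (π : Policy K) {σsq : ℝ≥0} (μ : Fin K → ℝ)

lemma exists_preimage_firstRounds {n : ℕ} {B : Set (ℕ → Round K)}
    (hB : MeasurableSet[history K n] B) :
    ∃ C, MeasurableSet C ∧ firstRounds n ⁻¹' C = B := hB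

lemma law_apply_eq_ratio (hσ : σsq ≠ 0) (μ' : Fin K → ℝ) {n : ℕ} {B : Set (ℕ → Round K)}
    (hB : MeasurableSet[history K n] B) :
    π.law σsq μ' B = ∫⁻ ω in B,
      ENNReal.ofReal (Real.exp (-∑ i ∈ Finset.range n, roundRatio σsq μ μ' (ω i)))
        ∂(π.law σsq μ) := by
  have hBm : MeasurableSet B := (history K).le n B hB
  obtain ⟨C, hC, rfl⟩ := exists_preimage_firstRounds hB
  have h := lintegral_law_eq_ratio π μ hσ μ' n (g := C.indicator 1)
    (measurable_one.indicator hC)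
  rw [← lintegral_indicator_one hBm, ← lintegral_indicator hBm]
  refine h.trans (lintegral_congr fun ω => ?_)
  by_cases hω : firstRounds n ω ∈ C
  · simp [hω]
  · simp [hω]

/-- The number of rounds played, with the value `0` if the policy never stops. -/
noncomputable def rounds (ω : ℕ → Round K) : ℕ := (π.stopTime ω).toNat

variable (σsq) in
/-- The log-likelihood ratio of the rounds played. -/
noncomputable def stoppedRatio (μ' : Fin K → ℝ) (ω : ℕ → Round K) : ℝ :=
  ∑ i ∈ Finset.range (rounds π ω), roundRatio σsq μ μ' (ω i)

lemma measurableSet_stopTime_eq (n : ℕ) : MeasurableSet[history K n] {ω | π.stopTime ω = n} :=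
  π.stopTime_isStoppingTime.measurableSet_eq_of_countable n

lemma measurableSet_stopTime_gt (n : ℕ) : MeasurableSet[history K n] {ω | n < π.stopTime ω} := by
  have h : {ω | (n : ℕ∞) < π.stopTime ω} = {ω | π.stopTime ω ≤ n}ᶜ := by ext; simp
  rw [h]
  exact (π.stopTime_isStoppingTime.measurableSet_le n).compl

lemma measurable_stopTime : Measurable π.stopTime :=
  measurable_to_countable' fun x => by
    induction x using ENat.recTopCoe with
    | top =>
      have h : π.stopTime ⁻¹' {⊤} = ⋂ n : ℕ, {ω | n < π.stopTime ω} := by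
        ext ω
        simp only [Set.mem_preimage, Set.mem_singleton_iff, Set.mem_iInter, Set.mem_ofPred_eq]
        exact ⟨fun h n => by simp [h], fun h => ENat.eq_top_iff_forall_gt.2 h⟩
      rw [h]
      exact MeasurableSet.iInter fun n => (history K).le n _ (measurableSet_stopTime_gt π n)
    | coe n => exact (history K).le n _ (measurableSet_stopTime_eq π n)

lemma measurable_stoppedRatio (μ' : Fin K → ℝ) : Measurable (stoppedRatio π σsq μ μ') := by
  have hr := measurable_roundRatio σsq μ μ'
  have h1 : Measurable (rounds π) := (measurable_of_countable ENat.toNat).comp (measurable_stopTime π)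
  have h2 : Measurable fun p : ℕ × (ℕ → Round K) =>
      ∑ i ∈ Finset.range p.1, roundRatio σsq μ μ' (p.2 i) :=
    measurable_from_prod_countable_right fun n =>
      Finset.measurable_sum (Finset.range n) fun i _ => hr.comp (measurable_pi_apply i)
  exact h2.comp (h1.prodMk measurable_id)

/-- Change of measure on the events that are known when the policy stops. -/
lemma law_apply_eq_stoppedRatio (hσ : σsq ≠ 0) (μ' : Fin K → ℝ) {A : Set (ℕ → Round K)}
    (hA : MeasurableSet[π.stopTime_isStoppingTime.measurableSpace] A)
    (hP : ∀ᵐ ω ∂(π.law σsq μ), π.stopTime ω < ⊤) (hP' : ∀ᵐ ω ∂(π.law σsq μ'), π.stopTime ω < ⊤) :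
    π.law σsq μ' A = ∫⁻ ω in A, ENNReal.ofReal (Real.exp (-stoppedRatio π σsq μ μ' ω))
      ∂(π.law σsq μ) := by
  have hAn : ∀ n : ℕ, MeasurableSet[history K n] (A ∩ {ω | π.stopTime ω = n}) := fun n => by
    have h : A ∩ {ω | π.stopTime ω = n} =
        (A ∩ {ω | π.stopTime ω ≤ n}) ∩ {ω | π.stopTime ω = n} := by
      ext ω; simp only [Set.mem_inter_iff, Set.mem_ofPred_eq]
      exact ⟨fun h => ⟨⟨h.1, h.2.le⟩, h.2⟩, fun h => ⟨h.1.1, h.2⟩⟩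
    rw [h]
    exact (hA.2 n).inter (measurableSet_stopTime_eq π n)
  have hm : ∀ n : ℕ, MeasurableSet (A ∩ {ω | π.stopTime ω = n}) := fun n =>
    (history K).le n _ (hAn n)
  have hd : Pairwise (Function.onFun Disjoint fun n : ℕ => A ∩ {ω | π.stopTime ω = n}) := by
    intro i j hij
    refine Set.disjoint_left.2 fun ω hi hj => hij ?_
    exact_mod_cast hi.2.symm.trans hj.2
  -- The slices on which the policy stops after exactly `n` rounds exhaust `A` only up to a null
  -- set. This is why almost sure stopping is needed under both laws.
  have hU : ∀ ν : Measure (ℕ → Round K), (∀ᵐ ω ∂ν, π.stopTime ω < ⊤) →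
      A =ᵐ[ν] ⋃ n : ℕ, A ∩ {ω | π.stopTime ω = n} := fun ν hν => by
    filter_upwards [hν] with ω hω
    refine propext ⟨fun h => Set.mem_iUnion.2 ⟨(π.stopTime ω).toNat, h, ?_⟩,
      fun h => (Set.mem_iUnion.1 h).choose_spec.1⟩
    exact (ENat.natCast_toNat hω.ne).symm
  rw [measure_congr (hU _ hP'), measure_iUnion hd hm, setLIntegral_congr (hU _ hP),
    lintegral_iUnion hm hd]
  refine tsum_congr fun n => ?_
  rw [law_apply_eq_ratio π μ hσ μ' (hAn n)]
  refine setLIntegral_congr_fun (hm n) fun ω hω => ?_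
  have h : π.stopTime ω = n := hω.2
  simp [stoppedRatio, rounds, h]

variable (σsq)

/-- The expected number of plays of an arm. -/
noncomputable def expectedPlays (a : Fin K) : ℝ≥0∞ :=
  ∑' t : ℕ, π.law σsq μ {ω | t < π.stopTime ω ∧ (ω t).1 = a}

/-- Whether round `t` is played is decided by the earlier rounds, and given the arm the reward is
fresh. So `f` may be replaced by its average over the reward of that arm. -/
lemma lintegral_stopped_round {f : Round K → ℝ≥0∞} (hf : Measurable f) (t : ℕ) :
    ∫⁻ ω in {ω | t < π.stopTime ω}, f (ω t) ∂(π.law σsq μ) =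
      ∑ a, (∫⁻ y, f (a, y) ∂(gaussianReal (μ a) σsq)) *
        π.law σsq μ {ω | t < π.stopTime ω ∧ (ω t).1 = a} := by
  have hm : MeasurableSet {ω | t < π.stopTime ω} :=
    (history K).le t _ (measurableSet_stopTime_gt π t)
  obtain ⟨C, hC, hCB⟩ := exists_preimage_firstRounds (measurableSet_stopTime_gt π t)
  have key : ∀ g : Round K → ℝ≥0∞, Measurable g →
      ∫⁻ ω in {ω | t < π.stopTime ω}, g (ω t) ∂(π.law σsq μ) =
      ∫⁻ ω in {ω | t < π.stopTime ω}, ∫⁻ a, ∫⁻ y, g (a, y) ∂(gaussianReal (μ a) σsq)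
        ∂(π.sample t (firstRounds t ω)) ∂(π.law σsq μ) := by
    intro g hg
    rw [← lintegral_indicator hm, ← lintegral_indicator hm]
    have hF : Measurable (Function.uncurry fun (x : Fin t → Round K) (r : Round K) =>
        C.indicator 1 x * g r) :=
      ((measurable_one.indicator hC).comp measurable_fst).mul (hg.comp measurable_snd)
    have h := lintegral_law_round π σsq μ t hF
    have hmem : ∀ ω, firstRounds t ω ∈ C ↔ t < π.stopTime ω := fun ω =>
      Set.ext_iff.1 hCB ω
    calc _ = _ := lintegral_congr fun ω => ?_
      _ = _ := h
      _ = _ := lintegral_congr fun ω => ?_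
    · by_cases hω : t < π.stopTime ω
      · simp [hω, (hmem ω).2 hω]
      · simp [hω, mt (hmem ω).1 hω]
    · by_cases hω : t < π.stopTime ω
      · simp [hω, (hmem ω).2 hω, lintegral_step _ _ _ _ _ hg]
      · simp [hω, mt (hmem ω).1 hω]
  have hind : ∀ a : Fin K, MeasurableSet {r : Round K | r.1 = a} := fun a =>
    measurable_fst (measurableSet_singleton a)
  have hfin : ∀ ω : ℕ → Round K, ∫⁻ y, f ((ω t).1, y) ∂(gaussianReal (μ (ω t).1) σsq) =
      ∑ a, (∫⁻ y, f (a, y) ∂(gaussianReal (μ a) σsq)) *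
        {ω : ℕ → Round K | (ω t).1 = a}.indicator 1 ω := by
    intro ω
    rw [Finset.sum_eq_single (ω t).1]
    · simp
    · intro b _ hb
      simp [Set.indicator, hb.symm]
    · simp
  have hbar : Measurable fun r : Round K => ∫⁻ y, f (r.1, y) ∂(gaussianReal (μ r.1) σsq) :=
    (measurable_of_countable fun a => ∫⁻ y, f (a, y) ∂(gaussianReal (μ a) σsq)).comp measurable_fst
  -- Averaging over the reward a second time changes nothing, so `key` gives the same right-hand
  -- side for `f` and for its average.
  have h2 := key _ hbar
  simp only [lintegral_const, measure_univ, mul_one] at h2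
  rw [key f hf, ← h2]
  simp_rw [hfin]
  have hind' : ∀ a : Fin K, MeasurableSet {ω : ℕ → Round K | (ω t).1 = a} := fun a =>
    (hind a).preimage (measurable_pi_apply t)
  rw [lintegral_finsetSum _ fun a _ => (measurable_one.indicator (hind' a)).const_mul _]
  refine Finset.sum_congr rfl fun a _ => ?_
  rw [lintegral_const_mul _ (measurable_one.indicator (hind' a)), lintegral_indicator_one (hind' a),
    Measure.restrict_apply (hind' a), Set.inter_comm]
  rfl

lemma tsum_indicator_stopTime {f : Round K → ℝ≥0∞} {ω : ℕ → Round K} (hω : π.stopTime ω < ⊤) :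
    ∑' t : ℕ, {ω | t < π.stopTime ω}.indicator (fun ω => f (ω t)) ω =
      ∑ i ∈ Finset.range (rounds π ω), f (ω i) := by
  have h : ((rounds π ω : ℕ) : ℕ∞) = π.stopTime ω := ENat.natCast_toNat hω.ne
  rw [tsum_eq_sum (s := Finset.range (rounds π ω))]
  · refine Finset.sum_congr rfl fun i hi => ?_
    have : (i : ℕ∞) < π.stopTime ω := by
      rw [← h]; exact_mod_cast Finset.mem_range.1 hi
    simp [this]
  · intro i hi
    have : ¬ (i : ℕ∞) < π.stopTime ω := by
      rw [← h]; exact_mod_cast fun h => hi (Finset.mem_range.2 h)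
    simp [this]

/-- Wald's identity for the rounds played. -/
lemma lintegral_sum_rounds {f : Round K → ℝ≥0∞} (hf : Measurable f)
    (hP : ∀ᵐ ω ∂(π.law σsq μ), π.stopTime ω < ⊤) :
    ∫⁻ ω, ∑ i ∈ Finset.range (rounds π ω), f (ω i) ∂(π.law σsq μ) =
      ∑ a, expectedPlays π σsq μ a * ∫⁻ y, f (a, y) ∂(gaussianReal (μ a) σsq) := by
  have hm : ∀ t : ℕ, MeasurableSet {ω | t < π.stopTime ω} := fun t =>
    (history K).le t _ (measurableSet_stopTime_gt π t)
  rw [lintegral_congr_ae (hP.mono fun ω hω => (tsum_indicator_stopTime π hω).symm),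
    lintegral_tsum fun t => ((show Measurable fun ω : ℕ → Round K => f (ω t) from
      hf.comp (measurable_pi_apply t)).indicator (hm t)).aemeasurable]
  simp_rw [fun t : ℕ => lintegral_indicator (μ := π.law σsq μ) (hm t) (fun ω => f (ω t)),
    lintegral_stopped_round π σsq μ hf]
  rw [Summable.tsum_finsetSum fun _ _ => ENNReal.summable]
  refine Finset.sum_congr rfl fun a _ => ?_
  rw [ENNReal.tsum_mul_left, mul_comm, expectedPlays]

lemma sum_expectedPlays (hP : ∀ᵐ ω ∂(π.law σsq μ), π.stopTime ω < ⊤) :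
    ∑ a, expectedPlays π σsq μ a = π.expectedStop σsq μ := by
  have h := lintegral_sum_rounds π σsq μ (f := fun _ => 1) measurable_const hP
  simp only [Finset.sum_const, Finset.card_range, nsmul_eq_mul, mul_one, lintegral_const,
    measure_univ] at h
  rw [← h, Policy.expectedStop]
  refine lintegral_congr_ae (hP.mono fun ω hω => ?_)
  have h : ((rounds π ω : ℕ) : ℕ∞) = π.stopTime ω := ENat.natCast_toNat hω.ne
  simp [← h]

end Stopping

end ChangePointBandit

namespace ChangePointBandit

/-! ### The transportation inequality and the lower bound by the characteristic time -/

section Bound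

/-- Wald's identity is available for nonnegative functions, so it is applied to the positive and
negative parts separately. A finite expected stopping time makes both results finite and allows the
subtraction. -/
lemma integrable_stoppedRatio_and_integral {K : ℕ} (π : Policy K) (σsq : ℝ≥0) (μ μ' : Fin K → ℝ)
    (hP : ∀ᵐ ω ∂(π.law σsq μ), π.stopTime ω < ⊤) (hE : π.expectedStop σsq μ ≠ ⊤) :
    Integrable (stoppedRatio π σsq μ μ') (π.law σsq μ) ∧
      ∫ ω, stoppedRatio π σsq μ μ' ω ∂(π.law σsq μ) =
        ∑ a, (expectedPlays π σsq μ a).toReal * ((μ a - μ' a) ^ 2 / (2 * σsq)) := by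
  have hN : ∀ a, expectedPlays π σsq μ a ≠ ⊤ := fun a h => hE <| by
    rw [← sum_expectedPlays π σsq μ hP]
    exact ENNReal.sum_eq_top.2 ⟨a, Finset.mem_univ a, h⟩
  have key : ∀ f : Round K → ℝ, Measurable f →
      (∀ a, Integrable (fun y => f (a, y)) (gaussianReal (μ a) σsq)) →
      Integrable (fun ω => (∑ i ∈ Finset.range (rounds π ω), ENNReal.ofReal (f (ω i))).toReal)
        (π.law σsq μ) ∧
      ∫ ω, (∑ i ∈ Finset.range (rounds π ω), ENNReal.ofReal (f (ω i))).toReal ∂(π.law σsq μ) =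
        ∑ a, (expectedPlays π σsq μ a).toReal *
          (∫⁻ y, ENNReal.ofReal (f (a, y)) ∂(gaussianReal (μ a) σsq)).toReal := by
    intro f hf hfi
    have hm : AEMeasurable (fun ω => ∑ i ∈ Finset.range (rounds π ω), ENNReal.ofReal (f (ω i)))
        (π.law σsq μ) := by
      have h1 : Measurable (rounds π) :=
        (measurable_of_countable ENat.toNat).comp (measurable_stopTime π)
      have h2 : Measurable fun p : ℕ × (ℕ → Round K) =>
          ∑ i ∈ Finset.range p.1, ENNReal.ofReal (f (p.2 i)) :=
        measurable_from_prod_countable_right fun n =>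
          Finset.measurable_sum (Finset.range n) fun i _ =>
            (hf.comp (measurable_pi_apply i)).ennreal_ofReal
      exact (h2.comp (h1.prodMk measurable_id)).aemeasurable
    have hw := lintegral_sum_rounds π σsq μ hf.ennreal_ofReal hP
    have hfin : ∀ a, expectedPlays π σsq μ a *
        ∫⁻ y, ENNReal.ofReal (f (a, y)) ∂(gaussianReal (μ a) σsq) ≠ ⊤ := fun a =>
      ENNReal.mul_ne_top (hN a) (hfi a).lintegral_lt_top.ne
    have hfin' : ∫⁻ ω, ∑ i ∈ Finset.range (rounds π ω), ENNReal.ofReal (f (ω i))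
        ∂(π.law σsq μ) ≠ ⊤ := by
      rw [hw]; exact ENNReal.sum_ne_top.2 fun a _ => hfin a
    refine ⟨integrable_toReal_of_lintegral_ne_top hm hfin', ?_⟩
    rw [integral_toReal hm (ae_of_all _ fun ω => ENNReal.sum_lt_top.2 fun i _ =>
      ENNReal.ofReal_lt_top), hw, ENNReal.toReal_sum fun a _ => hfin a]
    simp_rw [ENNReal.toReal_mul]
  have hr := measurable_roundRatio σsq μ μ'
  have hi : ∀ a, Integrable (fun y => roundRatio σsq μ μ' (a, y)) (gaussianReal (μ a) σsq) :=
    fun a => integrable_gaussianLogRatio σsq (μ a) (μ' a)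
  obtain ⟨h1, h2⟩ := key _ hr hi
  obtain ⟨h3, h4⟩ := key (fun r => -roundRatio σsq μ μ' r) hr.neg fun a => (hi a).neg
  have hS : stoppedRatio π σsq μ μ' = fun ω =>
      (∑ i ∈ Finset.range (rounds π ω), ENNReal.ofReal (roundRatio σsq μ μ' (ω i))).toReal -
      (∑ i ∈ Finset.range (rounds π ω), ENNReal.ofReal (-roundRatio σsq μ μ' (ω i))).toReal := by
    funext ω
    rw [ENNReal.toReal_sum fun i _ => ENNReal.ofReal_ne_top,
      ENNReal.toReal_sum fun i _ => ENNReal.ofReal_ne_top, ← Finset.sum_sub_distrib, stoppedRatio]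
    refine Finset.sum_congr rfl fun i _ => ?_
    simp only [ENNReal.toReal_ofReal']
    exact (max_zero_sub_max_neg_zero_eq_self _).symm
  rw [hS]
  refine ⟨h1.sub h3, ?_⟩
  rw [integral_sub h1 h3, h2, h4, ← Finset.sum_sub_distrib]
  refine Finset.sum_congr rfl fun a _ => ?_
  rw [← mul_sub, ← integral_eq_lintegral_pos_part_sub_lintegral_neg_part (hi a)]
  congr 1
  exact integral_gaussianLogRatio σsq (μ a) (μ' a)

/-- The right-hand side is the binary divergence of $1-\delta$ from $\delta$. Two lower bounds by
$-\log 2$ are added: one for minus the binary entropy, one for $\delta\log\delta$. Then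
$\log(1-\delta)\le 0$ replaces the factor $1-\delta$ by $1-2\delta$. -/
lemma log_inv_four_mul_le {δ : ℝ} (h0 : 0 < δ) (h1 : δ < 1 / 4) :
    Real.log (1 / (4 * δ)) ≤ (1 - 2 * δ) * (Real.log (1 - δ) - Real.log δ) := by
  have hent := Real.binEntropy_le_log_two (p := δ)
  rw [Real.binEntropy_eq_negMulLog_add_negMulLog_one_sub, Real.negMulLog, Real.negMulLog] at hent
  have h4 : Real.log 4 = 2 * Real.log 2 := by
    rw [show (4 : ℝ) = 2 ^ 2 by norm_num, Real.log_pow]; norm_num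
  have hl : Real.log (1 / (4 * δ)) = -(2 * Real.log 2) - Real.log δ := by
    rw [one_div, Real.log_inv, Real.log_mul (by norm_num) h0.ne', h4]; ring
  have h5 : -Real.log 2 ≤ δ * Real.log δ := by
    have := Real.one_sub_inv_le_log_of_pos (x := 2 * δ) (by linarith)
    rw [Real.log_mul (by norm_num) h0.ne', mul_inv] at this
    have h6 := mul_le_mul_of_nonneg_left this h0.le
    have h7 : δ * (1 - 2⁻¹ * δ⁻¹) = δ - 1 / 2 := by field_simp
    have h8 := Real.log_two_gt_d9
    nlinarith
  have h9 : Real.log (1 - δ) ≤ 0 := Real.log_nonpos (by linarith) (by linarith)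
  rw [hl]
  nlinarith

/-- Two laws that are told apart by an event have a large expected log-likelihood ratio. -/
lemma log_le_integral_of_likelihood_ratio {Ω : Type*} [MeasurableSpace Ω] {P P' : Measure Ω}
    [IsProbabilityMeasure P] [IsProbabilityMeasure P'] {S : Ω → ℝ} (hS : Integrable S P)
    (hSm : Measurable S)
    {E : Set Ω} (hE : MeasurableSet E)
    (h1 : P' E = ∫⁻ ω in E, ENNReal.ofReal (Real.exp (-S ω)) ∂P)
    (h2 : P' Eᶜ = ∫⁻ ω in Eᶜ, ENNReal.ofReal (Real.exp (-S ω)) ∂P)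
    {δ : ℝ} (h0 : 0 < δ) (hδ : δ < 1 / 4) (hp : 1 - δ ≤ P.real E) (hq : P'.real E ≤ δ) :
    Real.log (1 / (4 * δ)) ≤ ∫ ω, S ω ∂P := by
  have key : ∀ A : Set Ω, MeasurableSet A →
      P' A = ∫⁻ ω in A, ENNReal.ofReal (Real.exp (-S ω)) ∂P → ∀ c : ℝ, 0 < c →
      -∫ ω in A, S ω ∂P ≤ P'.real A / c + (Real.log c - 1) * P.real A := by
    intro A hA h c hc
    have hm : AEStronglyMeasurable (fun ω => Real.exp (-S ω)) (P.restrict A) :=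
      hSm.neg.exp.aestronglyMeasurable
    have hint : Integrable (fun ω => Real.exp (-S ω)) (P.restrict A) := by
      refine ⟨hm, ?_⟩
      rw [hasFiniteIntegral_iff_ofReal (ae_of_all _ fun ω => (Real.exp_pos _).le), ← h]
      exact measure_lt_top _ _
    have hval : ∫ ω in A, Real.exp (-S ω) ∂P = P'.real A := by
      rw [integral_eq_lintegral_of_nonneg_ae (ae_of_all _ fun ω => (Real.exp_pos _).le) hm, ← h]
      rfl
    calc -∫ ω in A, S ω ∂P = ∫ ω in A, -S ω ∂P := (integral_neg _).symm
      _ ≤ ∫ ω in A, (Real.exp (-S ω) / c + (Real.log c - 1)) ∂P := by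
        refine integral_mono hS.integrableOn.neg ((hint.div_const c).add (integrable_const _)) ?_
        intro ω
        -- The tangent line of the exponential at $\log c$ takes the place of Jensen's inequality
        -- and needs no division by the probability of `A`.
        have := Real.add_one_le_exp (-S ω - Real.log c)
        rw [Real.exp_sub, Real.exp_log hc] at this
        change -S ω ≤ _
        linarith
      _ = _ := by
        rw [integral_add (hint.div_const c) (integrable_const _), integral_div, hval,
          integral_const]
        simp [mul_comm]
  have hd : 0 < 1 - δ := by linarith
  -- These values of `c` are the likelihood ratios in the extremal case, where `E` has probability
  -- $1-\delta$ under `P` and $\delta$ under `P'`.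
  have k1 := key E hE h1 (δ / (1 - δ)) (by positivity)
  have k2 := key Eᶜ hE.compl h2 ((1 - δ) / δ) (by positivity)
  rw [Real.log_div (by positivity) (by positivity)] at k1 k2
  rw [probReal_compl_eq_one_sub hE, probReal_compl_eq_one_sub hE] at k2
  have hlog : Real.log δ ≤ Real.log (1 - δ) := Real.log_le_log h0 (by linarith)
  have hsum := integral_add_compl hE hS
  refine (log_inv_four_mul_le h0 hδ).trans ?_
  rw [← hsum]
  set q := P'.real E
  set p := P.real E
  -- The left side is affine and increasing in $q$, with value $1$ at $q=\delta$.
  have e1 : q / (δ / (1 - δ)) + (1 - q) / ((1 - δ) / δ) ≤ 1 := by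
    have : q / (δ / (1 - δ)) + (1 - q) / ((1 - δ) / δ) - 1 =
        (q - δ) * (1 - 2 * δ) / (δ * (1 - δ)) := by
      field_simp; ring
    have : (q - δ) * (1 - 2 * δ) / (δ * (1 - δ)) ≤ 0 :=
      div_nonpos_of_nonpos_of_nonneg
        (mul_nonpos_of_nonpos_of_nonneg (by linarith) (by linarith)) (by positivity)
    linarith
  nlinarith [mul_nonneg (sub_nonneg.2 hp) (sub_nonneg.2 hlog)]

lemma Policy.IsExact.ae_stopTime_lt_top {K N s : ℕ} {σsq : ℝ≥0} {δ : ℝ} {π : Policy K}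
    (hπ : π.IsExact σsq N s δ) {μ : Fin K → ℝ} (hμ : μ ∈ envs K N s) :
    ∀ᵐ ω ∂(π.law σsq μ), π.stopTime ω < ⊤ :=
  (prob_compl_eq_zero_iff (measurable_stopTime π (Set.to_countable {x | x < ⊤}).measurableSet)).2
    (hπ μ hμ).2

/-- The transportation inequality between an environment and an alternative. -/
lemma log_le_sum_expectedPlays {K N s : ℕ} {σsq : ℝ≥0} (hσ : σsq ≠ 0) {δ : ℝ} (h0 : 0 < δ)
    (hδ : δ < 1 / 4) {π : Policy K} (hπ : π.IsExact σsq N s δ) {μ μ' : Fin K → ℝ}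
    (hμ : μ ∈ envs K N s) (hμ' : μ' ∈ altEnvs N s μ) (hE : π.expectedStop σsq μ ≠ ⊤) :
    Real.log (1 / (4 * δ)) ≤
      ∑ a, (expectedPlays π σsq μ a).toReal * ((μ a - μ' a) ^ 2 / (2 * σsq)) := by
  have hfin : ∀ ν ∈ envs K N s, ∀ᵐ ω ∂(π.law σsq ν), π.stopTime ω < ⊤ := fun ν hν =>
    hπ.ae_stopTime_lt_top hν
  obtain ⟨hi, hI⟩ := integrable_stoppedRatio_and_integral π σsq μ μ' (hfin μ hμ) hE
  rw [← hI]
  have hrec := π.recommend_measurable (changePoints μ)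
  have hle := π.stopTime_isStoppingTime.measurableSpace_le
  have conv : ∀ ν ∈ envs K N s, 1 - δ ≤ (π.law σsq ν).real {ω | π.recommend ω = changePoints ν} :=
    fun ν hν => ENNReal.ofReal_le_iff_le_toReal (measure_ne_top _ _) |>.1 (hπ ν hν).1.le
  refine log_le_integral_of_likelihood_ratio (P' := π.law σsq μ')
    (E := {ω | π.recommend ω = changePoints μ}) hi
    (measurable_stoppedRatio π μ μ') (hle _ hrec)
    (law_apply_eq_stoppedRatio π μ hσ μ' hrec (hfin μ hμ) (hfin μ' hμ'.1))
    (law_apply_eq_stoppedRatio π μ hσ μ' hrec.compl (hfin μ hμ) (hfin μ' hμ'.1)) h0 hδ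
    (conv μ hμ) ?_
  have hsub : {ω | π.recommend ω = changePoints μ} ⊆
      {ω | π.recommend ω = changePoints μ'}ᶜ := fun ω hω hω' =>
    hμ'.2 (hω'.symm.trans hω)
  have h3 := measureReal_mono (μ := π.law σsq μ') hsub
  rw [probReal_compl_eq_one_sub (hle _ (π.recommend_measurable _))] at h3
  have h4 := conv μ' hμ'.1
  linarith

/-- The sampling rule is a probability measure on the arms, which cannot live on an empty type. -/
lemma Policy.pos_arms {K : ℕ} (π : Policy K) : 0 < K := by
  rcases Nat.eq_zero_or_pos K with rfl | h
  · have h1 := measure_univ (μ := π.sample 0 Fin.elim0)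
    simp [Set.univ_eq_empty_iff.2 (inferInstance : IsEmpty (Fin 0))] at h1
  · exact h

lemma cStar_mul_log_le_expectedStop {K N s : ℕ} {σsq : ℝ≥0} (hσ : σsq ≠ 0) {δ : ℝ} (h0 : 0 < δ)
    {π : Policy K} (hπ : π.IsExact σsq N s δ) {μ : Fin K → ℝ} (hμ : μ ∈ envs K N s) :
    cStar σsq N s μ * ENNReal.ofReal (Real.log (1 / (4 * δ))) ≤ π.expectedStop σsq μ := by
  rcases le_or_gt (1 / 4) δ with hδ | hδ
  · have : Real.log (1 / (4 * δ)) ≤ 0 :=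
      Real.log_nonpos (by positivity) ((div_le_one (by positivity)).2 (by linarith))
    rw [ENNReal.ofReal_of_nonpos this, mul_zero]
    exact zero_le
  rcases eq_or_ne (π.expectedStop σsq μ) ⊤ with hE | hE
  · simp [hE]
  have hfin := hπ.ae_stopTime_lt_top hμ
  have hL : 0 < Real.log (1 / (4 * δ)) :=
    Real.log_pos ((one_lt_div (by positivity)).2 (by linarith))
  set L := Real.log (1 / (4 * δ))
  set T := (π.expectedStop σsq μ).toReal with hT
  set n := fun a => (expectedPlays π σsq μ a).toReal
  have hsumE := sum_expectedPlays π σsq μ hfin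
  have hn : ∑ a, n a = T := by
    rw [hT, ← hsumE, ENNReal.toReal_sum]
    intro a _ h
    exact hE (hsumE ▸ ENNReal.sum_eq_top.2 ⟨a, Finset.mem_univ a, h⟩)
  have hn0 : ∀ a, 0 ≤ n a := fun a => ENNReal.toReal_nonneg
  have hkl : ∀ μ' ∈ altEnvs N s μ, L ≤ ∑ a, n a * ((μ a - μ' a) ^ 2 / (2 * σsq)) := fun μ' hμ' =>
    log_le_sum_expectedPlays hσ h0 hδ hπ hμ hμ' hE
  have hET : π.expectedStop σsq μ = ENNReal.ofReal T := (ENNReal.ofReal_toReal hE).symm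
  -- A lower bound on the infimum at one weight vector bounds the supremum below, hence its inverse
  -- above.
  have hsup : ∀ α ∈ stdSimplex ℝ (Fin K), ∀ c : ℝ≥0∞,
      (∀ μ' ∈ altEnvs N s μ, c ≤ ENNReal.ofReal (∑ a, α a * ((μ a - μ' a) ^ 2 / (2 * σsq)))) →
      cStar σsq N s μ ≤ c⁻¹ := by
    intro α hα c hc
    rw [cStar, ENNReal.inv_le_inv]
    refine le_iSup₂_of_le α hα (le_iInf₂ fun μ' hμ' => (hc μ' hμ').trans_eq ?_)
    rw [ENNReal.ofReal_sum_of_nonneg fun a _ => mul_nonneg (hα.1 a) (by positivity)]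
    refine Finset.sum_congr rfl fun a _ => ?_
    rw [klDiv_gaussianReal hσ, ENNReal.ofReal_mul (hα.1 a)]
  rcases (ENNReal.toReal_nonneg (a := π.expectedStop σsq μ)).eq_or_lt with hT0 | hT0
  -- If no round is expected, `hkl` would give `L ≤ 0` for any alternative. So there are none, and
  -- the characteristic time vanishes.
  · have hz : ∀ a, n a = 0 := fun a =>
      (Finset.sum_eq_zero_iff_of_nonneg fun a _ => hn0 a).1 (hn.trans hT0.symm) a
        (Finset.mem_univ a)
    have hc := hsup (Pi.single ⟨0, π.pos_arms⟩ 1) (single_mem_stdSimplex ℝ _) ⊤ fun μ' hμ' => by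
      have := hkl μ' hμ'
      simp only [hz, zero_mul, Finset.sum_const_zero] at this
      exact absurd this hL.not_ge
    rw [ENNReal.inv_top, nonpos_iff_eq_zero] at hc
    simp [hc]
  · have hT' : 0 < T := hT0
    have hα : (fun a => n a / T) ∈ stdSimplex ℝ (Fin K) :=
      ⟨fun a => div_nonneg (hn0 a) hT'.le, by rw [← Finset.sum_div, hn, div_self hT'.ne']⟩
    have hc := hsup _ hα (ENNReal.ofReal (L / T)) fun μ' hμ' => by
      refine ENNReal.ofReal_le_ofReal ?_
      rw [div_le_iff₀ hT', Finset.sum_mul]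
      refine (hkl μ' hμ').trans_eq (Finset.sum_congr rfl fun a _ => ?_)
      field_simp
    calc _ ≤ (ENNReal.ofReal (L / T))⁻¹ * ENNReal.ofReal L := by gcongr
      _ = _ := by
        rw [← ENNReal.ofReal_inv_of_pos (by positivity), ← ENNReal.ofReal_mul (by positivity), hET]
        congr 1
        field_simp

end Bound

end ChangePointBandit

namespace ChangePointBandit

/-! ### Alternatives obtained by moving one change, and the explicit bound -/

section Shift

variable {K N s : ℕ}

lemma mem_changePoints {μ : Fin K → ℝ} {j : Fin K} :
    j ∈ changePoints μ ↔ ∃ h : (j : ℕ) + 1 < K, μ j ≠ μ ⟨j + 1, h⟩ := by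
  simp [changePoints]

/-- The environment `μ` with the means on both sides of `j` replaced by `m`. -/
noncomputable def flatten (μ : Fin K → ℝ) (j : Fin K) (m : ℝ) : Fin K → ℝ := fun i =>
  if (i : ℕ) = j ∨ (i : ℕ) = j + 1 then m else μ i

/-- Distinct changes of an environment in `envs K N (s + 1)` are at distance at least `s + 1`. -/
lemma apart_of_mem_envs {μ : Fin K → ℝ} (hμ : μ ∈ envs K N (s + 1)) {i j : Fin K}
    (hi : i ∈ changePoints μ) (hj : j ∈ changePoints μ) (hij : (i : ℕ) ≠ j) :
    (i : ℕ) + (s + 1) ≤ j ∨ (j : ℕ) + (s + 1) ≤ i := by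
  rcases lt_or_gt_of_ne hij with h | h
  · exact Or.inl (hμ.2 i hi j hj h)
  · exact Or.inr (hμ.2 j hj i hi h)

/-- Moving a change by one arm shortens its distance to any other by at most one, from `s + 1` to
`s`. As `s + 1 ≥ 2`, the neighbouring arm `k` was not already a change, so the number of changes is
preserved. -/
lemma mem_altEnvs_of_changePoints_eq (hs : 1 ≤ s) {μ μ' : Fin K → ℝ} (hμ : μ ∈ envs K N (s + 1))
    {j k : Fin K} (hj : j ∈ changePoints μ) (hk : (k : ℕ) + 1 = j ∨ (j : ℕ) + 1 = k)
    (h : changePoints μ' = insert k ((changePoints μ).erase j)) : μ' ∈ altEnvs N s μ := by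
  have hkj : k ≠ j := fun e => by subst e; omega
  have hkn : k ∉ changePoints μ := fun hk' => by
    have := apart_of_mem_envs hμ hk' hj (fun e => hkj (Fin.ext e))
    omega
  refine ⟨⟨?_, fun a ha b hb hab => ?_⟩, fun e => ?_⟩
  · rw [h, Finset.card_insert_of_notMem (fun h' => hkn (Finset.mem_of_mem_erase h')),
      Finset.card_erase_add_one hj, hμ.1]
  · rw [h, Finset.mem_insert, Finset.mem_erase] at ha hb
    have hab' : (a : ℕ) < b := hab
    rcases ha with rfl | ⟨haj, ha⟩ <;> rcases hb with rfl | ⟨hbj, hb⟩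
    · exact absurd hab (lt_irrefl _)
    · have := apart_of_mem_envs hμ hb hj (fun e => hbj (Fin.ext e))
      omega
    · have := apart_of_mem_envs hμ ha hj (fun e => haj (Fin.ext e))
      omega
    · have := hμ.2 a ha b hb hab
      omega
  · have : j ∈ changePoints μ' := e ▸ hj
    rw [h] at this
    simp [hkj.symm] at this

lemma mem_changePoints_flatten_iff_of_ne {μ : Fin K → ℝ} {i j : Fin K} {m : ℝ}
    (h0 : (i : ℕ) + 1 ≠ j) (h1 : (i : ℕ) ≠ j) (h2 : (i : ℕ) ≠ j + 1) :
    i ∈ changePoints (flatten μ j m) ↔ i ∈ changePoints μ := by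
  rw [mem_changePoints, mem_changePoints]
  simp [flatten, h0, h1, h2]

lemma notMem_changePoints_flatten {μ : Fin K → ℝ} {j : Fin K} {m : ℝ} :
    j ∉ changePoints (flatten μ j m) := by
  rw [mem_changePoints]
  simp [flatten]

/-- The arm before `j` has the mean of `j`, so a level other than `μ j` creates a change at `j - 1`.
The level must match the old mean of `j + 1` only if an arm follows `j + 1`; at the right end it is
free. -/
lemma flatten_left_mem_altEnvs (hs : 1 ≤ s) {μ : Fin K → ℝ} (hμ : μ ∈ envs K N (s + 1))
    {j : Fin K} (hj : j ∈ changePoints μ) (hj0 : 0 < (j : ℕ)) {m : ℝ} (hm : m ≠ μ j)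
    (hr : ∀ h : (j : ℕ) + 2 < K, m = μ ⟨j + 1, by omega⟩) : flatten μ j m ∈ altEnvs N s μ := by
  have hap : ∀ i ∈ changePoints μ, (i : ℕ) ≠ j → (i : ℕ) + 2 ≤ j ∨ (j : ℕ) + 2 ≤ i :=
    fun i hi hij => by have := apart_of_mem_envs hμ hi hj hij; omega
  refine mem_altEnvs_of_changePoints_eq hs hμ hj (k := ⟨j - 1, by omega⟩)
    (Or.inl (Nat.sub_add_cancel hj0)) (Finset.ext fun i => ?_)
  rw [Finset.mem_insert, Finset.mem_erase]
  simp only [Fin.ext_iff, ne_eq]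
  by_cases h1 : (i : ℕ) = j
  · obtain rfl : i = j := Fin.ext h1
    simp [notMem_changePoints_flatten]
    omega
  by_cases h0 : (i : ℕ) + 1 = j
  · have hi : i ∉ changePoints μ := fun hi => by have := hap i hi h1; omega
    have hij : (⟨i + 1, by omega⟩ : Fin K) = j := Fin.ext h0
    rw [mem_changePoints] at hi
    push Not at hi
    have hμi := hi (by omega)
    rw [hij] at hμi
    refine iff_of_true ?_ (Or.inl (by omega))
    rw [mem_changePoints]
    refine ⟨by omega, ?_⟩
    have h2 : (i : ℕ) ≠ j + 1 := by omega
    simp only [flatten, h0, h1, h2, or_self, if_false, true_or, if_true, hμi]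
    exact hm.symm
  have h3 : (i : ℕ) ≠ j - 1 := by omega
  by_cases h2 : (i : ℕ) = j + 1
  · have hi : i ∉ changePoints μ := fun hi => by have := hap i hi h1; omega
    refine iff_of_false ?_ (by tauto)
    rw [mem_changePoints] at hi ⊢
    push Not at hi ⊢
    intro h
    have hij : (⟨j + 1, by omega⟩ : Fin K) = i := Fin.ext h2.symm
    have hmi := hr (by omega)
    rw [hij] at hmi
    have h4 : ¬ ((i : ℕ) + 1 = j ∨ (i : ℕ) + 1 = j + 1) := by omega
    simp only [flatten, if_neg h4, if_pos (show (i : ℕ) = j ∨ (i : ℕ) = j + 1 from Or.inr h2), hmi]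
    exact hi h
  · rw [mem_changePoints_flatten_iff_of_ne h0 h1 h2]
    tauto

/-- Mirror image of `flatten_left_mem_altEnvs`: the level is free when `j` is the first arm. -/
lemma flatten_right_mem_altEnvs (hs : 1 ≤ s) {μ : Fin K → ℝ} (hμ : μ ∈ envs K N (s + 1))
    {j : Fin K} (hj : j ∈ changePoints μ) (hjK : (j : ℕ) + 2 < K) {m : ℝ}
    (hm : m ≠ μ ⟨j + 1, by omega⟩) (hl : 0 < (j : ℕ) → m = μ j) :
    flatten μ j m ∈ altEnvs N s μ := by
  have hap : ∀ i ∈ changePoints μ, (i : ℕ) ≠ j → (i : ℕ) + 2 ≤ j ∨ (j : ℕ) + 2 ≤ i :=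
    fun i hi hij => by have := apart_of_mem_envs hμ hi hj hij; omega
  refine mem_altEnvs_of_changePoints_eq hs hμ hj (k := ⟨j + 1, by omega⟩)
    (Or.inr rfl) (Finset.ext fun i => ?_)
  rw [Finset.mem_insert, Finset.mem_erase]
  simp only [Fin.ext_iff, ne_eq]
  by_cases h1 : (i : ℕ) = j
  · obtain rfl : i = j := Fin.ext h1
    simp [notMem_changePoints_flatten]
  by_cases h2 : (i : ℕ) = j + 1
  · have hi : i ∉ changePoints μ := fun hi => by have := hap i hi h1; omega
    have hij : (⟨j + 1, by omega⟩ : Fin K) = i := Fin.ext h2.symm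
    rw [mem_changePoints] at hi
    push Not at hi
    have hμi := hi (by omega)
    refine iff_of_true ?_ (Or.inl h2)
    rw [mem_changePoints]
    refine ⟨by omega, ?_⟩
    rw [hij] at hm
    have h4 : ¬ ((i : ℕ) + 1 = j ∨ (i : ℕ) + 1 = j + 1) := by omega
    simp only [flatten, if_neg h4, if_pos (show (i : ℕ) = j ∨ (i : ℕ) = j + 1 from Or.inr h2),
      ← hμi]
    exact hm
  by_cases h0 : (i : ℕ) + 1 = j
  · have hi : i ∉ changePoints μ := fun hi => by have := hap i hi h1; omega
    refine iff_of_false ?_ (by tauto)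
    rw [mem_changePoints] at hi ⊢
    push Not at hi ⊢
    intro h
    have hij : (⟨i + 1, by omega⟩ : Fin K) = j := Fin.ext h0
    have hμi := hi h
    rw [hij] at hμi
    simp only [flatten, h0, h1, h2, or_self, if_false, true_or, if_true, hμi]
    exact (hl (by omega)).symm
  · rw [mem_changePoints_flatten_iff_of_ne h0 h1 h2]
    tauto

lemma sum_mul_sq_sub_flatten (α : Fin K → ℝ) (μ : Fin K → ℝ) (j : Fin K) (h : (j : ℕ) + 1 < K)
    (m : ℝ) : ∑ i, α i * (μ i - flatten μ j m i) ^ 2 =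
      α j * (μ j - m) ^ 2 + α ⟨j + 1, h⟩ * (μ ⟨j + 1, h⟩ - m) ^ 2 := by
  have hne : j ≠ ⟨j + 1, h⟩ := fun e => by simpa using congrArg Fin.val e
  rw [Finset.sum_eq_add_of_mem j ⟨j + 1, h⟩ (Finset.mem_univ _) (Finset.mem_univ _) hne]
  · simp [flatten]
  · rintro c - ⟨h1, h2⟩
    have h1' : (c : ℕ) ≠ j := fun e => h1 (Fin.ext e)
    have h2' : (c : ℕ) ≠ j + 1 := fun e => h2 (Fin.ext e)
    simp [flatten, h1', h2']

/-- Moving one change to a neighbouring arm gives a close alternative. -/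
lemma exists_altEnvs_sum_le (hK : 3 ≤ K) (hs : 1 ≤ s) {μ : Fin K → ℝ}
    (hμ : μ ∈ envs K N (s + 1)) {α : Fin K → ℝ} (hα : ∀ i, 0 ≤ α i) {j : Fin K}
    (hj : j ∈ changePoints μ) (h : (j : ℕ) + 1 < K) :
    ∃ μ' ∈ altEnvs N s μ, ∑ i, α i * (μ i - μ' i) ^ 2 ≤
      (α j + α ⟨j + 1, h⟩) * jump μ j ^ 2 / 2 := by
  have hjump : jump μ j ^ 2 = (μ j - μ ⟨j + 1, h⟩) ^ 2 := by simp [jump, h]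
  have hne : μ j ≠ μ ⟨j + 1, h⟩ := (mem_changePoints.1 hj).2
  have hsq := sq_nonneg (μ j - μ ⟨j + 1, h⟩)
  have h0 := hα j
  have h1 := hα ⟨j + 1, h⟩
  rw [hjump]
  set x := μ j
  set y := μ ⟨j + 1, h⟩
  -- At an end of the row only one direction is possible, and its one-sided cost may exceed the
  -- claim. The level is free there, and the midpoint costs only a quarter of
  -- $(\alpha_j+\alpha_{j+1})\Delta_j^2$.
  have hmid : ∑ i, α i * (μ i - flatten μ j ((x + y) / 2) i) ^ 2 ≤
      (α j + α ⟨j + 1, h⟩) * (x - y) ^ 2 / 2 := by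
    rw [sum_mul_sq_sub_flatten _ _ _ h]
    nlinarith [mul_nonneg (add_nonneg h0 h1) hsq]
  have hmx : (x + y) / 2 ≠ x := fun e => hne (by linarith)
  have hmy : (x + y) / 2 ≠ y := fun e => hne (by linarith)
  rcases Nat.eq_zero_or_pos (j : ℕ) with hj0 | hj0
  · exact ⟨_, flatten_right_mem_altEnvs hs hμ hj (by omega) hmy (by omega), hmid⟩
  rcases lt_or_ge ((j : ℕ) + 2) K with hjK | hjK
  -- In the interior both directions are possible. The change moves so that the arm of smaller
  -- weight is altered, and the minimum of the two weights is at most their mean.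
  · rcases le_total (α j) (α ⟨j + 1, h⟩) with hle | hle
    · refine ⟨_, flatten_left_mem_altEnvs hs hμ hj hj0 hne.symm fun _ => rfl, ?_⟩
      rw [sum_mul_sq_sub_flatten _ _ _ h]
      nlinarith [mul_nonneg (sub_nonneg.2 hle) hsq]
    · refine ⟨_, flatten_right_mem_altEnvs hs hμ hj hjK hne fun _ => rfl, ?_⟩
      rw [sum_mul_sq_sub_flatten _ _ _ h]
      nlinarith [mul_nonneg (sub_nonneg.2 hle) hsq]
  · exact ⟨_, flatten_left_mem_altEnvs hs hμ hj hj0 hmx (fun h' => by omega), hmid⟩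

lemma jump_pos {μ : Fin K → ℝ} {j : Fin K} (hj : j ∈ changePoints μ) : 0 < jump μ j := by
  obtain ⟨h, hne⟩ := mem_changePoints.1 hj
  simpa [jump, h, sub_eq_zero] using hne

/-- The weight of the arms next to some change is small compared to the size of the change. -/
lemma exists_changePoint_weight_le (hs : 1 ≤ s) {μ : Fin K → ℝ}
    (hμ : μ ∈ envs K N (s + 1)) (hN : (changePoints μ).Nonempty) {α : Fin K → ℝ}
    (hα : α ∈ stdSimplex ℝ (Fin K)) :
    ∃ j ∈ changePoints μ, ∃ h : (j : ℕ) + 1 < K,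
      (α j + α ⟨j + 1, h⟩) * jump μ j ^ 2 ≤ (∑ j ∈ changePoints μ, 1 / jump μ j ^ 2)⁻¹ := by
  set S := ∑ j ∈ changePoints μ, 1 / jump μ j ^ 2 with hSdef
  have hS : 0 < S := Finset.sum_pos (fun j hj => by have := jump_pos hj; positivity) hN
  by_contra! hcon
  -- The right neighbour as a total map; the default value is never met at a change point.
  let f : Fin K → Fin K := fun j => if h : (j : ℕ) + 1 < K then ⟨j + 1, h⟩ else j
  have hf : ∀ (j : Fin K) (h : (j : ℕ) + 1 < K), f j = ⟨j + 1, h⟩ := fun j h => dif_pos h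
  have hlt : ∑ j ∈ changePoints μ, S⁻¹ * (1 / jump μ j ^ 2) <
      ∑ j ∈ changePoints μ, (α j + α (f j)) := by
    refine Finset.sum_lt_sum_of_nonempty hN fun j hj => ?_
    obtain ⟨h, -⟩ := mem_changePoints.1 hj
    have := jump_pos hj
    rw [hf j h, mul_one_div, div_lt_iff₀ (by positivity)]
    exact hcon j hj h
  rw [← Finset.mul_sum, inv_mul_cancel₀ hS.ne', Finset.sum_add_distrib] at hlt
  have hinj : Set.InjOn f (changePoints μ) := fun a ha b hb hab => by
    obtain ⟨h, -⟩ := mem_changePoints.1 ha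
    obtain ⟨h', -⟩ := mem_changePoints.1 hb
    rw [hf a h, hf b h', Fin.mk.injEq] at hab
    exact Fin.ext (by omega)
  -- Changes are at distance at least two, so the right neighbour of a change is not a change and no
  -- arm's weight is counted twice.
  have hdisj : Disjoint (changePoints μ) ((changePoints μ).image f) := by
    rw [Finset.disjoint_left]
    intro a ha hb
    obtain ⟨b, hb', rfl⟩ := Finset.mem_image.1 hb
    obtain ⟨h, -⟩ := mem_changePoints.1 hb'
    rw [hf b h] at ha
    have := apart_of_mem_envs hμ ha hb' (by simp)
    simp only at this
    omega
  rw [← Finset.sum_image hinj, ← Finset.sum_union hdisj] at hlt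
  have := Finset.sum_le_sum_of_subset_of_nonneg (f := α) (Finset.subset_univ
    (changePoints μ ∪ (changePoints μ).image f)) fun i _ _ => hα.1 i
  rw [hα.2] at this
  exact absurd hlt this.not_gt

lemma sum_inv_sq_jump_le_cStar (hK : 3 ≤ K) (hs : 1 ≤ s) {σsq : ℝ≥0} (hσ : σsq ≠ 0)
    {μ : Fin K → ℝ} (hμ : μ ∈ envs K N (s + 1)) :
    ENNReal.ofReal (4 * σsq * ∑ j ∈ changePoints μ, 1 / jump μ j ^ 2) ≤ cStar σsq N s μ := by
  rcases (changePoints μ).eq_empty_or_nonempty with h0 | hN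
  · simp [h0]
  have hσ' : (0 : ℝ) < σsq := by exact_mod_cast pos_iff_ne_zero.2 hσ
  set S := ∑ j ∈ changePoints μ, 1 / jump μ j ^ 2 with hSdef
  have hS : 0 < S := Finset.sum_pos (fun j hj => by have := jump_pos hj; positivity) hN
  rw [cStar, ENNReal.le_inv_iff_le_inv, ← ENNReal.ofReal_inv_of_pos (by positivity)]
  refine iSup₂_le fun α hα => ?_
  obtain ⟨j, hj, h, hle⟩ := exists_changePoint_weight_le hs hμ hN hα
  obtain ⟨μ', hμ', hsum⟩ := exists_altEnvs_sum_le hK hs hμ hα.1 hj h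
  refine iInf₂_le_of_le μ' hμ' ?_
  simp_rw [klDiv_gaussianReal hσ, ← ENNReal.ofReal_mul (hα.1 _)]
  rw [← ENNReal.ofReal_sum_of_nonneg fun a _ => mul_nonneg (hα.1 a) (by positivity)]
  refine ENNReal.ofReal_le_ofReal ?_
  calc ∑ i, α i * ((μ i - μ' i) ^ 2 / (2 * σsq))
      = (∑ i, α i * (μ i - μ' i) ^ 2) / (2 * σsq) := by
        rw [Finset.sum_div]; exact Finset.sum_congr rfl fun i _ => (mul_div_assoc _ _ _).symm
    _ ≤ (S⁻¹ / 2) / (2 * σsq) := by gcongr; linarith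
    _ = (4 * σsq * S)⁻¹ := by field_simp; norm_num

end Shift

end ChangePointBandit

theorem mainTheorem3 {K N s : ℕ} (hs : 1 ≤ s) (σsq : ℝ≥0) (hσ : 0 < σsq)
    (δ : ℝ) (hδ₀ : 0 < δ) (hδ₁ : δ < 1)
    (π : ChangePointBandit.Policy K) (hπ : π.IsExact σsq N s δ)
    (μ : Fin K → ℝ) (hμ : μ ∈ ChangePointBandit.envs K N s) :
    ChangePointBandit.cStar σsq N s μ * ENNReal.ofReal (Real.log (1 / (4 * δ)))
        ≤ π.expectedStop σsq μ ∧
    (3 ≤ K → μ ∈ ChangePointBandit.envs K N (s + 1) →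
      ENNReal.ofReal (4 * σsq * ∑ j ∈ ChangePointBandit.changePoints μ,
          1 / ChangePointBandit.jump μ j ^ 2)
        ≤ ChangePointBandit.cStar σsq N s μ ∧
      ENNReal.ofReal (4 * σsq * Real.log (1 / (4 * δ)) *
          ∑ j ∈ ChangePointBandit.changePoints μ, 1 / ChangePointBandit.jump μ j ^ 2)
        ≤ ChangePointBandit.cStar σsq N s μ * ENNReal.ofReal (Real.log (1 / (4 * δ))) ∧
      ENNReal.ofReal (4 * σsq * Real.log (1 / (4 * δ)) *
          ∑ j ∈ ChangePointBandit.changePoints μ, 1 / ChangePointBandit.jump μ j ^ 2)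
        ≤ π.expectedStop σsq μ) := by
  have h1 := ChangePointBandit.cStar_mul_log_le_expectedStop hσ.ne' hδ₀ hπ hμ
  refine ⟨h1, fun hK hμs => ?_⟩
  have h2 := ChangePointBandit.sum_inv_sq_jump_le_cStar hK hs hσ.ne' hμs
  have h3 : ENNReal.ofReal (4 * σsq * Real.log (1 / (4 * δ)) *
      ∑ j ∈ ChangePointBandit.changePoints μ, 1 / ChangePointBandit.jump μ j ^ 2) ≤
      ChangePointBandit.cStar σsq N s μ * ENNReal.ofReal (Real.log (1 / (4 * δ))) := by
    -- The nonnegative factor is split off first because the logarithm may be negative;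
    -- `ENNReal.ofReal` then truncates it to zero, as $\log^+$ does.
    rw [mul_right_comm, ENNReal.ofReal_mul (mul_nonneg (by positivity)
      (Finset.sum_nonneg fun j _ => by positivity))]
    gcongr
  exact ⟨h2, h3, h3.trans h1⟩
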